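/- Let $\delta \le \kappa$ be uncountable cardinals. For a cardinal $\mu$, a (proper) filter over a set is called $\mu$-complete if it is closed under intersections of fewer than $\mu$ of its members, and a topological space $X$ is called $\mu$-Lindelöf if every open cover of $X$ has a subcover of cardinality $<\mu$. The cardinal $\kappa$ is called $\delta$-strongly compact if for every set $A$, every $\kappa$-complete filter over $A$ can be extended to a $\delta$-complete ultrafilter over $A$. Then the following are equivalent: 1. $\kappa$ is $\delta$-strongly compact. 2. For every family $\{X_i \mid i \in I\}$ of $\delta$-Lindelöf spaces, the product space $\prod_{i \in I} X_i$ is $\kappa$-Lindelöf. -/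

import Mathlib

open scoped Cardinal

universe u

/-- `κ` is `δ`-strongly compact: on every set `A`, every proper `κ`-complete filter over `A` extends
to a `δ`-complete ultrafilter over `A`. Here a filter is `c`-complete (`CardinalInterFilter`) if it
is closed under intersections of fewer than `c` of its members; in Mathlib's order on filters,
`U ≤ F` says that every member of `F` is a member of `U`. -/
def IsDeltaStronglyCompact (δ κ : Cardinal.{u}) : Prop :=
  ∀ (A : Type u) (F : Filter A), F.NeBot → CardinalInterFilter F κ →
    ∃ U : Ultrafilter A, (U : Filter A) ≤ F ∧ CardinalInterFilter (U : Filter A) δ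

/-- A topological space `X` is `μ`-Lindelöf if every open cover of `X` has a subcover of
cardinality less than `μ`. -/
def IsCardinalLindelof (μ : Cardinal.{u}) (X : Type u) [TopologicalSpace X] : Prop :=
  ∀ C : Set (Set X), (∀ O ∈ C, IsOpen O) → ⋃₀ C = Set.univ →
    ∃ D : Set (Set X), D ⊆ C ∧ #D < μ ∧ ⋃₀ D = Set.univ

open Cardinal Set Filter Topology

/-! Forward: strong compactness gives a `δ`-complete ultrafilter and sets `x t ⊆ C` of size `< κ`
such that each member of the cover `C` is in almost every `x t` (`exists_fine_family`). If no `x t`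
covers, pick a point missed by each; these points converge coordinatewise along the ultrafilter, and
a member of `C` around the limit gives a contradiction. For singular `κ` the sets are first found
with size `≤ κ`, then thinned. Backward: a product of small discrete spaces encodes
`δ`-completeness, and a cluster point of the filter there yields the ultrafilter. -/

theorem exists_fine_ultrafilter_of_isRegular {δ κ θ : Cardinal.{u}}
    (h : IsDeltaStronglyCompact δ κ) (hθ : θ.IsRegular) (hκθ : κ ≤ θ) (C : Type u) :
    ∃ U : Ultrafilter {x : Set C // #x < θ}, CardinalInterFilter (U : Filter {x : Set C // #x < θ}) δ ∧
      ∀ c, ∀ᶠ x in (U : Filter {x : Set C // #x < θ}), c ∈ x.1 := by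
  -- Regularity of `θ` makes the filter generated by the cones `{x | B ⊆ x}` `θ`-complete.
  have key : ∀ S : Set (Set {x : Set C // #x < θ}), #S < θ →
      (∀ s ∈ S, ∃ B : Set C, #B < θ ∧ ∀ x : {x : Set C // #x < θ}, B ⊆ x.1 → x ∈ s) →
      ∃ B : Set C, #B < θ ∧ ∀ x : {x : Set C // #x < θ}, B ⊆ x.1 → x ∈ ⋂₀ S := by
    intro S hS hB
    choose B hB hBs using hB
    refine ⟨⋃ s : S, B s.1 s.2, ?_, fun x hx s hs ↦ hBs s hs x ?_⟩
    · rw [card_iUnion_lt_iff_forall_of_isRegular hθ hS]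
      exact fun s ↦ hB _ _
    · exact (subset_iUnion (fun s : S ↦ B s.1 s.2) ⟨s, hs⟩).trans hx
  let F : Filter {x : Set C // #x < θ} :=
    { sets := {s | ∃ B : Set C, #B < θ ∧ ∀ x : {x : Set C // #x < θ}, B ⊆ x.1 → x ∈ s}
      univ_sets := ⟨∅, by simpa using hθ.pos, fun _ _ ↦ mem_univ _⟩
      sets_of_superset := fun ⟨B, hB, hBs⟩ hst ↦ ⟨B, hB, fun x hx ↦ hst (hBs x hx)⟩
      inter_sets := by
        intro s t hs ht
        rw [← sInter_pair]
        refine key {s, t} (lt_of_lt_of_le ?_ hθ.aleph0_le) ?_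
        · exact Set.Finite.lt_aleph0 (by simp)
        · rintro r (rfl | rfl)
          exacts [hs, ht] }
  have hF : F.NeBot := by
    refine ⟨fun hbot ↦ ?_⟩
    obtain ⟨B, hB, hBs⟩ := empty_mem_iff_bot.2 hbot
    exact hBs ⟨B, hB⟩ subset_rfl
  obtain ⟨U, hUF, hU⟩ := h _ F hF ⟨fun S hS hSF ↦ key S (hS.trans_le hκθ) hSF⟩
  refine ⟨U, hU, fun c ↦ hUF ⟨{c}, ?_, fun x hx ↦ hx rfl⟩⟩
  rw [mk_singleton]
  exact one_lt_aleph0.trans_le hθ.aleph0_le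

theorem wellFounded_eventually_lt {T L : Type*} [Preorder L] [WellFoundedLT L] (l : Filter T)
    [l.NeBot] [CountableInterFilter l] :
    WellFounded (fun f g : T → L ↦ ∀ᶠ t in l, f t < g t) := by
  rw [wellFounded_iff_isEmpty_descending_chain]
  refine ⟨fun ⟨f, hf⟩ ↦ ?_⟩
  obtain ⟨t, ht⟩ := (eventually_countable_forall.2 hf).exists
  exact (wellFounded_iff_isEmpty_descending_chain.1 (wellFounded_lt (α := L))).false
    ⟨fun n ↦ f n t, ht⟩

/-- A function which is unbounded modulo `l` while every smaller function is bounded. -/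
theorem exists_minimal_unbounded {T L : Type*} [LinearOrder L] [WellFoundedLT L]
    (l : Filter T) [l.NeBot] [CountableInterFilter l] (s : T → L)
    (hs : ∀ b, ∀ᶠ t in l, b < s t) :
    ∃ g : T → L, (∀ b, ∀ᶠ t in l, b < g t) ∧
      ∀ f : T → L, (∀ᶠ t in l, f t < g t) → ∃ b, ¬ ∀ᶠ t in l, b < f t := by
  obtain ⟨g, hg, hmin⟩ := (wellFounded_eventually_lt l).has_min
    {g : T → L | ∀ b, ∀ᶠ t in l, b < g t} ⟨s, hs⟩
  refine ⟨g, hg, fun f hf ↦ ?_⟩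
  by_contra! hb
  exact hmin f hb hf

/-- A cofinality is its own cofinality, so one that is at most a singular `κ` cannot equal `κ`. -/
theorem exists_small_cofinal {κ : Cardinal.{u}} (hκ : ℵ₀ ≤ κ) (hsing : ¬ κ.IsRegular)
    {L : Type u} [LinearOrder L] [WellFoundedLT L] (s : Set L) (hs : #s ≤ κ) (b : L)
    (hcof : ∀ a < b, ∃ d ∈ s, a ≤ d ∧ d < b) :
    ∃ D : Set L, #D < κ ∧ ∀ a < b, ∃ d ∈ D, a ≤ d ∧ d < b := by
  have hle : Order.cof (Iio b) ≤ κ := by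
    refine (Order.cof_le (s := {d : Iio b | d.1 ∈ s}) ?_).trans (le_trans ?_ hs)
    · rintro ⟨a, ha⟩
      obtain ⟨d, hd, had, hdb⟩ := hcof a ha
      exact ⟨⟨d, hdb⟩, hd, had⟩
    · exact mk_le_of_injective (f := fun d : {d : Iio b | d.1 ∈ s} ↦ (⟨d.1.1, d.2⟩ : s))
        fun d e hde ↦ by
          simp only [Subtype.mk.injEq] at hde
          exact Subtype.ext (Subtype.ext hde)
  have hlt : Order.cof (Iio b) < κ := by
    refine lt_of_le_of_ne hle fun heq ↦ hsing ⟨hκ, ?_⟩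
    rw [← heq, Order.cof_ord_cof]
  obtain ⟨D, hD, hDc⟩ := Order.exists_cof_eq (Iio b)
  refine ⟨Subtype.val '' D, mk_image_le.trans_lt (hDc ▸ hlt), fun a ha ↦ ?_⟩
  obtain ⟨d, hd, had⟩ := hD ⟨a, ha⟩
  exact ⟨d, ⟨d, hd, rfl⟩, had, d.2⟩

/-- If `D` meets, for every `a`, an interval `[a, f a)` eventually, then there are families of
pairwise disjoint intervals indexed by `L`, and recording which of them `D t` meets produces sets
no larger than `D t` that eventually contain any given index. -/
theorem exists_fine_of_intervals {T L : Type u} [LinearOrder L] [WellFoundedLT L] (l : Filter T)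
    (hL : ∀ (i : L) (b : Iio i → L), ∃ a, ∀ j, b j ≤ a)
    (D : T → Set L) (hD : ∀ a, ∃ c, ∀ᶠ t in l, ∃ d ∈ D t, a ≤ d ∧ d < c) :
    ∃ E : T → Set L, (∀ t, #(E t) ≤ #(D t)) ∧ ∀ i, ∀ᶠ t in l, i ∈ E t := by
  choose f hf using hD
  choose sup hsup using hL
  let b : L → L := (wellFounded_lt (α := L)).fix fun i ih ↦ f (sup i fun j ↦ ih j.1 j.2)
  have hb : ∀ i, b i = f (sup i fun j ↦ b j.1) := fun i ↦ WellFounded.fix_eq _ _ _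
  refine ⟨fun t ↦ {i | ∃ d ∈ D t, (∀ j < i, b j ≤ d) ∧ d < b i}, fun t ↦ ?_, fun i ↦ ?_⟩
  · have h : ∀ i : {i | ∃ d ∈ D t, (∀ j < i, b j ≤ d) ∧ d < b i},
        ∃ d : D t, (∀ j < i.1, b j ≤ d) ∧ d < b i.1 := by
      rintro ⟨i, d, hd, h⟩
      exact ⟨⟨d, hd⟩, h⟩
    choose d hd hd' using h
    refine mk_le_of_injective (f := d) fun i j hij ↦ ?_
    rcases lt_trichotomy i.1 j.1 with h | h | h
    · exact absurd (hd' i) (not_lt.2 (hij ▸ hd j _ h))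
    · exact Subtype.ext h
    · exact absurd (hd' j) (not_lt.2 (hij ▸ hd i _ h))
  · filter_upwards [hf (sup i fun j ↦ b j.1)] with t ⟨d, hd, hle, hlt⟩
    exact ⟨d, hd, fun j hj ↦ (hsup i (fun j ↦ b j.1) ⟨j, hj⟩).trans hle, (hb i).symm ▸ hlt⟩

theorem exists_fine_of_not_isRegular {T L : Type u} [LinearOrder L] [WellFoundedLT L]
    [NoMaxOrder L] {κ : Cardinal.{u}} (hκ : ℵ₀ ≤ κ) (hsing : ¬ κ.IsRegular)
    (hL : ∀ (i : L) (b : Iio i → L), ∃ a, ∀ j, b j ≤ a)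
    (U : Ultrafilter T) [CountableInterFilter (U : Filter T)] (x : T → Set L)
    (hxκ : ∀ t, #(x t) ≤ κ) (hbdd : ∀ t, ∃ a, ∀ d ∈ x t, d < a)
    (hx : ∀ b, ∀ᶠ t in (U : Filter T), b ∈ x t) :
    ∃ E : T → Set L, (∀ t, #(E t) < κ) ∧ ∀ i, ∀ᶠ t in (U : Filter T), i ∈ E t := by
  choose s hs using hbdd
  obtain ⟨g, hg, hmin⟩ := exists_minimal_unbounded (U : Filter T) s fun b ↦
    (hx b).mono fun t ht ↦ hs t b ht
  -- Otherwise `x t` misses `[f t, g t)` for some `f < g`; minimality of `g` gives `b ≥ f t`, and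
  -- fineness puts `b` in that gap.
  have hcof : ∀ᶠ t in (U : Filter T), ∀ a < g t, ∃ d ∈ x t, a ≤ d ∧ d < g t := by
    by_contra hcon
    rw [← Ultrafilter.eventually_not] at hcon
    have hcon' : ∀ t, ∃ a, (¬ ∀ a < g t, ∃ d ∈ x t, a ≤ d ∧ d < g t) →
        a < g t ∧ ∀ d ∈ x t, a ≤ d → g t ≤ d := by
      intro t
      by_cases ht : ∀ a < g t, ∃ d ∈ x t, a ≤ d ∧ d < g t
      · exact ⟨g t, fun h ↦ (h ht).elim⟩
      · push Not at ht
        obtain ⟨a, ha⟩ := ht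
        exact ⟨a, fun _ ↦ ha⟩
    choose f hf using hcon'
    obtain ⟨b, hb⟩ := hmin f (hcon.mono fun t ht ↦ (hf t ht).1)
    rw [← Ultrafilter.eventually_not] at hb
    obtain ⟨t, h₁, h₂, h₃, h₄⟩ := (hcon.and (hb.and ((hg b).and (hx b)))).exists
    exact (h₃.trans_le ((hf t h₁).2 b h₄ (not_lt.1 h₂))).false
  have hD : ∀ t, ∃ D : Set L, #D < κ ∧ ((∀ a < g t, ∃ d ∈ x t, a ≤ d ∧ d < g t) →
      ∀ a < g t, ∃ d ∈ D, a ≤ d ∧ d < g t) := by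
    intro t
    by_cases ht : ∀ a < g t, ∃ d ∈ x t, a ≤ d ∧ d < g t
    · obtain ⟨D, hDκ, hD⟩ := exists_small_cofinal hκ hsing (x t) (hxκ t) (g t) ht
      exact ⟨D, hDκ, fun _ ↦ hD⟩
    · exact ⟨∅, by simpa using aleph0_pos.trans_le hκ, fun h ↦ (ht h).elim⟩
  choose D hDκ hD using hD
  -- Choosing `d t ∈ D t` in `[a, g t)` gives a function below `g`, hence bounded by minimality.
  obtain ⟨E, hE, hEx⟩ := exists_fine_of_intervals (U : Filter T) hL D fun a ↦ by
    have h : ∀ t, ∃ d, (∀ a < g t, ∃ d ∈ x t, a ≤ d ∧ d < g t) → a < g t →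
        d ∈ D t ∧ a ≤ d ∧ d < g t := by
      intro t
      by_cases ht : (∀ a < g t, ∃ d ∈ x t, a ≤ d ∧ d < g t) ∧ a < g t
      · obtain ⟨d, hd⟩ := hD t ht.1 a ht.2
        exact ⟨d, fun _ _ ↦ hd⟩
      · exact ⟨a, fun h₁ h₂ ↦ (ht ⟨h₁, h₂⟩).elim⟩
    choose d hd using h
    have hd' := (hcof.and (hg a)).mono fun t ht ↦ hd t ht.1 ht.2
    obtain ⟨b, hb⟩ := hmin d (hd'.mono fun t ht ↦ ht.2.2)
    rw [← Ultrafilter.eventually_not] at hb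
    obtain ⟨c, hc⟩ := exists_gt b
    exact ⟨c, (hd'.and hb).mono fun t ht ↦
      ⟨d t, ht.1.1, ht.1.2.1, (not_lt.1 ht.2).trans_lt hc⟩⟩
  exact ⟨E, fun t ↦ (hE t).trans_lt (hDκ t), hEx⟩

theorem exists_bound_of_card_lt {θ : Cardinal.{u}} (hθ : θ.IsRegular) (s : Set θ.ord.ToType)
    (hs : #s < θ) : ∃ a, ∀ d ∈ s, d < a := by
  have h : ¬ IsCofinal s := fun h ↦ by
    have := Order.cof_le h
    rw [Ordinal.cof_toType, hθ.cof_ord] at this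
    exact this.not_gt hs
  simpa [IsCofinal] using h

theorem exists_fine_family {δ κ : Cardinal.{u}} (hδ : ℵ₀ < δ) (hκ : ℵ₀ ≤ κ)
    (h : IsDeltaStronglyCompact δ κ) (C : Type u) :
    ∃ (T : Type u) (U : Ultrafilter T) (x : T → Set C), CardinalInterFilter (U : Filter T) δ ∧
      (∀ t, #(x t) < κ) ∧ ∀ c, ∀ᶠ t in (U : Filter T), c ∈ x t := by
  by_cases hreg : κ.IsRegular
  · obtain ⟨U, hU, hx⟩ := exists_fine_ultrafilter_of_isRegular h hreg le_rfl C
    exact ⟨_, U, fun x ↦ x.1, hU, fun x ↦ x.2, hx⟩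
  set θ : Cardinal.{u} := Order.succ (max κ #C)
  have hθ : θ.IsRegular := isRegular_succ (hκ.trans (le_max_left _ _))
  have hκθ : κ < θ := Order.lt_succ_of_le (le_max_left _ _)
  have hCθ : #C ≤ #θ.ord.ToType := by
    rw [mk_toType, card_ord]
    exact (le_max_right _ _).trans (Order.le_succ _)
  obtain ⟨ι⟩ := hCθ
  -- The successor of `κ` is regular, at the price of sets of size `κ`.
  obtain ⟨U, hU, hx⟩ := exists_fine_ultrafilter_of_isRegular h (isRegular_succ hκ)
    (Order.le_succ κ) θ.ord.ToType
  have : CountableInterFilter (U : Filter {x : Set θ.ord.ToType // #x < Order.succ κ}) :=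
    have := hU
    CardinalInterFilter.toCountableInterFilter _ hδ
  have : NoMaxOrder θ.ord.ToType := ⟨fun a ↦ by
    obtain ⟨b, hb⟩ := exists_bound_of_card_lt hθ {a} (by
      rw [mk_singleton]
      exact one_lt_aleph0.trans_le hθ.aleph0_le)
    exact ⟨b, hb a rfl⟩⟩
  obtain ⟨E, hE, hEx⟩ := exists_fine_of_not_isRegular hκ hreg
    (fun i b ↦ by
      obtain ⟨a, ha⟩ := exists_bound_of_card_lt hθ (range b)
        (mk_range_le.trans_lt (mk_Iio_toType_ord_lt i))
      exact ⟨a, fun j ↦ (ha _ ⟨j, rfl⟩).le⟩)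
    U (fun t ↦ t.1) (fun t ↦ Order.lt_succ_iff.1 t.2)
    (fun t ↦ exists_bound_of_card_lt hθ t.1 ((Order.lt_succ_iff.1 t.2).trans_lt hκθ)) hx
  refine ⟨_, U, fun t ↦ ι ⁻¹' E t, hU, fun t ↦ ?_, fun c ↦ hEx (ι c)⟩
  exact (mk_preimage_of_injective _ _ ι.injective).trans_lt (hE t)

theorem IsCardinalLindelof.exists_le_nhds {δ : Cardinal.{u}} {X : Type u} [TopologicalSpace X]
    (hX : IsCardinalLindelof δ X) (U : Ultrafilter X) (hU : CardinalInterFilter (U : Filter X) δ) :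
    ∃ x, (U : Filter X) ≤ 𝓝 x := by
  by_contra! hcon
  have hcov : ⋃₀ {O : Set X | IsOpen O ∧ O ∉ U} = Set.univ := by
    refine eq_univ_of_forall fun x ↦ ?_
    have := hcon x
    rw [(nhds_basis_opens x).ge_iff] at this
    push Not at this
    obtain ⟨O, ⟨hxO, hO⟩, hOU⟩ := this
    exact ⟨O, ⟨hO, hOU⟩, hxO⟩
  obtain ⟨D, hDC, hDδ, hD⟩ := hX _ (fun O hO ↦ hO.1) hcov
  have hmem : ⋂₀ (compl '' D) ∈ (U : Filter X) := by
    refine hU.cardinal_sInter_mem _ (mk_image_le.trans_lt hDδ) ?_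
    rintro _ ⟨O, hO, rfl⟩
    exact Ultrafilter.compl_mem_iff_notMem.2 (hDC hO).2
  rw [← compl_sUnion, hD, compl_univ] at hmem
  exact U.empty_notMem hmem

theorem CardinalInterFilter.ultrafilter_map {δ : Cardinal.{u}} {T X : Type u} (U : Ultrafilter T)
    (hU : CardinalInterFilter (U : Filter T) δ) (f : T → X) :
    CardinalInterFilter (U.map f : Filter X) δ := by
  refine ⟨fun S hS hSU ↦ ?_⟩
  have h : ⋂₀ (preimage f '' S) ∈ (U : Filter T) := by
    refine hU.cardinal_sInter_mem _ (mk_image_le.trans_lt hS) ?_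
    rintro _ ⟨s, hs, rfl⟩
    exact hSU s hs
  rw [sInter_image, ← preimage_sInter] at h
  exact h

theorem IsDeltaStronglyCompact.isCardinalLindelof_pi {δ κ : Cardinal.{u}} (hδ : ℵ₀ < δ)
    (hκ : ℵ₀ ≤ κ) (h : IsDeltaStronglyCompact δ κ) {I : Type u} {X : I → Type u}
    [∀ i, TopologicalSpace (X i)] (hX : ∀ i, IsCardinalLindelof δ (X i)) :
    IsCardinalLindelof κ (∀ i, X i) := by
  intro C hCo hC
  by_contra! hcon
  obtain ⟨T, U, x, hU, hxκ, hx⟩ := exists_fine_family hδ hκ h C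
  have hp : ∀ t, ∃ p : ∀ i, X i, ∀ O ∈ x t, p ∉ O.1 := by
    intro t
    have := hcon (Subtype.val '' x t) (by simp) (mk_image_le.trans_lt (hxκ t))
    rw [ne_univ_iff_exists_notMem] at this
    obtain ⟨p, hp⟩ := this
    exact ⟨p, fun O hO hpO ↦ hp ⟨O, ⟨O, hO, rfl⟩, hpO⟩⟩
  choose p hp using hp
  have hlim : ∀ i, ∃ y, Tendsto (fun t ↦ p t i) (U : Filter T) (𝓝 y) := fun i ↦
    (hX i).exists_le_nhds _ (CardinalInterFilter.ultrafilter_map U hU fun t ↦ p t i)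
  choose y hy using hlim
  obtain ⟨O, hO, hyO⟩ : y ∈ ⋃₀ C := hC ▸ mem_univ y
  obtain ⟨t, ht, ht'⟩ := (((tendsto_pi_nhds.2 hy).eventually ((hCo O hO).mem_nhds hyO)).and
    (hx ⟨O, hO⟩)).exists
  exact hp t _ ht' ht

theorem isCardinalLindelof_of_card_lt {δ : Cardinal.{u}} {X : Type u} [TopologicalSpace X]
    (hX : #X < δ) : IsCardinalLindelof δ X := by
  intro C _ hC
  have h : ∀ x : X, ∃ O ∈ C, x ∈ O := fun x ↦ by
    have : x ∈ ⋃₀ C := hC ▸ mem_univ x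
    exact this
  choose O hO hxO using h
  exact ⟨range O, range_subset_iff.2 hO, mk_range_le.trans_lt hX,
    eq_univ_of_forall fun x ↦ ⟨O x, ⟨x, rfl⟩, hxO x⟩⟩

theorem IsCardinalLindelof.exists_neBot_inf_comap_nhds {κ : Cardinal.{u}} {A Y : Type u}
    [TopologicalSpace Y] (hY : IsCardinalLindelof κ Y) (F : Filter A) [F.NeBot]
    (hF : CardinalInterFilter F κ) (e : A → Y) : ∃ y, (F ⊓ comap e (𝓝 y)).NeBot := by
  by_contra! hcon
  have hcov : ⋃₀ {O : Set Y | IsOpen O ∧ (e ⁻¹' O)ᶜ ∈ F} = Set.univ := by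
    refine eq_univ_of_forall fun y ↦ ?_
    have hbot := hcon y
    obtain ⟨s, hs, t, ht, hst⟩ := inf_eq_bot_iff.1 hbot
    obtain ⟨N, hN, hNt⟩ := ht
    obtain ⟨O, hON, hO, hyO⟩ := mem_nhds_iff.1 hN
    refine ⟨O, ⟨hO, mem_of_superset hs fun a ha haO ↦ ?_⟩, hyO⟩
    exact (hst ▸ (⟨ha, hNt (hON haO)⟩ : a ∈ s ∩ t) : a ∈ (∅ : Set A))
  obtain ⟨D, hDC, hDκ, hD⟩ := hY _ (fun O hO ↦ hO.1) hcov
  have hmem : ⋂₀ ((fun O ↦ (e ⁻¹' O)ᶜ) '' D) ∈ F := by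
    refine hF.cardinal_sInter_mem _ (mk_image_le.trans_lt hDκ) ?_
    rintro _ ⟨O, hO, rfl⟩
    exact (hDC hO).2
  obtain ⟨a, ha⟩ := F.nonempty_of_mem hmem
  obtain ⟨O, hO, haO⟩ : e a ∈ ⋃₀ D := hD ▸ mem_univ _
  exact ha _ ⟨O, hO, rfl⟩ haO

theorem isDeltaStronglyCompact_of_isCardinalLindelof_pi {δ κ : Cardinal.{u}} (hδ : ℵ₀ < δ)
    (h : ∀ (I : Type u) (X : I → Type u) [∀ i, TopologicalSpace (X i)],
      (∀ i, IsCardinalLindelof δ (X i)) → IsCardinalLindelof κ (∀ i, X i)) :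
    IsDeltaStronglyCompact δ κ := by
  intro A F hF hFκ
  -- Coordinate `S` of `e a` names a member of `S` omitting `a`, or is `none` if there is none.
  let X : {S : Set (Set A) // #S < δ} → Type u := fun S ↦ Option S.1
  let _ : ∀ S, TopologicalSpace (X S) := fun _ ↦ ⊥
  have : ∀ S, DiscreteTopology (X S) := fun _ ↦ ⟨rfl⟩
  have hX : ∀ S, IsCardinalLindelof δ (X S) := fun S ↦ isCardinalLindelof_of_card_lt <| by
    rw [mk_option]
    exact add_lt_of_lt hδ.le S.2 (one_lt_aleph0.trans hδ)
  have he : ∀ a S, ∃ o : X S, (∀ B : S.1, o = some B → a ∉ B.1) ∧ (o = none → a ∈ ⋂₀ S.1) := by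
    intro a S
    by_cases ha : a ∈ ⋂₀ S.1
    · exact ⟨none, fun _ hB ↦ (Option.some_ne_none _ hB.symm).elim, fun _ ↦ ha⟩
    · simp only [mem_sInter, not_forall] at ha
      obtain ⟨B, hB, haB⟩ := ha
      exact ⟨some ⟨B, hB⟩, fun _ h ↦ Option.some.inj h ▸ haB, fun h ↦ (Option.some_ne_none _ h).elim⟩
  choose e he_some he_none using he
  obtain ⟨y, hy⟩ := (h _ X hX).exists_neBot_inf_comap_nhds F hFκ e
  refine ⟨Ultrafilter.of (F ⊓ comap e (𝓝 y)), (Ultrafilter.of_le _).trans inf_le_left,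
    ⟨fun S hS hSU ↦ ?_⟩⟩
  have hlim : Tendsto e (Ultrafilter.of (F ⊓ comap e (𝓝 y)) : Filter A) (𝓝 y) :=
    tendsto_iff_comap.2 ((Ultrafilter.of_le _).trans inf_le_right)
  have hev : ∀ᶠ a in (Ultrafilter.of (F ⊓ comap e (𝓝 y)) : Filter A), e a ⟨S, hS⟩ = y ⟨S, hS⟩ := by
    have := tendsto_pi_nhds.1 hlim ⟨S, hS⟩
    exact tendsto_pure.1 (this.trans_eq (congrFun (nhds_discrete _) _))
  -- A limit value `some B` would make almost every `a` avoid `B`, although `B` is in the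
  -- ultrafilter.
  rcases hyS : y ⟨S, hS⟩ with _ | B
  · exact hev.mono fun a ha ↦ he_none a ⟨S, hS⟩ (ha.trans hyS)
  · obtain ⟨a, ha, haB⟩ := (hev.and (hSU B.1 B.2)).exists
    exact (he_some a ⟨S, hS⟩ B (ha.trans hyS) haB).elim

theorem theorem1p3 (δ κ : Cardinal.{u}) (hδ : ℵ₀ < δ) (hδκ : δ ≤ κ) :
    IsDeltaStronglyCompact δ κ ↔
      ∀ (I : Type u) (X : I → Type u) [∀ i, TopologicalSpace (X i)],
        (∀ i, IsCardinalLindelof δ (X i)) → IsCardinalLindelof κ (∀ i, X i) :=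
  ⟨fun h _ _ _ hX ↦ h.isCardinalLindelof_pi hδ (hδ.le.trans hδκ) hX,
    isDeltaStronglyCompact_of_isCardinalLindelof_pi hδ⟩
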